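/- For a natural number $m$ let $\sigma(m)$ be the sum of its base two digits and let $[m]$ be the set of powers of $2$ occurring in its base two expansion. Let $S(n,k)$ be the Stirling numbers of the second kind and $\nu$ the $2$-adic valuation. For $1\le k\le n$ the almost minimum zero estimate is $\nu(S(n,k))\ge \sigma(k)-\sigma(n)+\#([n]\cap[n-k])$, and the shifted almost minimum zero estimate is $\nu(S(n,k))\ge \sigma(k-1)-\sigma(n-1)+\#([n-1]\cap[n-k])$. Either estimate is called sharp if equality holds. $S(n,k)$ is a minimum zero case (MZC) if $\nu(S(n,k))=\sigma(k)-\sigma(n)$, and a shifted minimum zero case (SMZC) if $\nu(S(n,k))=\sigma(k-1)-\sigma(n-1)$. It is an almost minimum zero case (AMZC) if the almost minimum zero estimate is sharp and it is not a MZC, and a shifted almost minimum zero case (SAMZC) in the strict sense if the shifted almost minimum zero estimate is sharp and it is not a SMZC. **Theorem 3.4.** Let $c\ge 3$ be odd, $h\ge 0$ and $n=c2^h$. (i) If $1\le k\le 2^h$, then $S(n,k)$ is an AMZC and $\nu(S(n,k))=\sigma(k)-1$ (Lengyel's extension of De Wannemacker's theorem). (ii) If $k=2^h+a$ with $0<a<2^h$,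 then the lower bound in the almost minimum zero estimate is $\sigma(k)-\sigma(n)+\#([n]\cap[n-k])=\sigma(a)=\sigma(k)-1$, and $\nu(S(n,k))\ge\sigma(a)$. (iii) If $k=2^h+a$ with $0<a<2^h-1$ (so $2^h<k<2^{h+1}-1$), then the almost minimum zero estimate is not sharp (in particular $S(n,k)$ is not an AMZC), and $\nu(S(n,k))\ge\sigma(a)+1=\sigma(k)$. If $a=2^h-1$, so that $k=2^{h+1}-1$, then $S(n,k)$ is an AMZC and $\nu(S(n,k))=\sigma(a)=h$. (iv) If $k=2^{h+1}$, then $S(n,k)$ is an AMZC and the shifted almost minimum zero estimate is also sharp; $S(n,k)$ is a SAMZC in the strict sense if and only if $\sigma(c)\ge 3$. Moreover $\nu(S(n,k))=0$, i.e. $S(n,k)$ is odd. -/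

import Mathlib

namespace StirlingTwo

/-- The sum of the base two digits of `n`. -/
def sigma (n : ℕ) : ℕ := (Nat.digits 2 n).sum

/-- The set of the powers of two that occur in the base two expansion of `n`.
(A bit of `n` in place `i` forces `i < 2 ^ i ≤ n`, so all places are in `Finset.range n`.) -/
def twoPowers (n : ℕ) : Finset ℕ :=
  ((Finset.range n).filter (fun i => n.testBit i = true)).image (fun i => 2 ^ i)

/-- The 2-adic valuation of the Stirling number of the second kind `S(n,k)`, as an integer;
it is meant for `1 ≤ k ≤ n`, where `S(n,k)` is positive. -/
def nuS (n k : ℕ) : ℤ := (padicValNat 2 (Nat.stirlingSecond n k) : ℤ)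

/-- The minimum zero estimate. -/
def mzEstimate (n k : ℕ) : ℤ := (sigma k : ℤ) - (sigma n : ℤ)

/-- The almost minimum zero estimate. -/
def amzEstimate (n k : ℕ) : ℤ :=
  (sigma k : ℤ) - (sigma n : ℤ) + ((twoPowers n ∩ twoPowers (n - k)).card : ℤ)

/-- The shifted minimum zero estimate. -/
def smzEstimate (n k : ℕ) : ℤ := (sigma (k - 1) : ℤ) - (sigma (n - 1) : ℤ)

/-- The shifted almost minimum zero estimate. -/
def samzEstimate (n k : ℕ) : ℤ :=
  (sigma (k - 1) : ℤ) - (sigma (n - 1) : ℤ)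
    + ((twoPowers (n - 1) ∩ twoPowers (n - k)).card : ℤ)

/-- Minimum zero case: the minimum zero estimate is sharp. -/
def IsMZC (n k : ℕ) : Prop := nuS n k = mzEstimate n k

/-- Shifted minimum zero case: the shifted minimum zero estimate is sharp. -/
def IsSMZC (n k : ℕ) : Prop := nuS n k = smzEstimate n k

/-- The almost minimum zero estimate is sharp (minimum zero cases included). -/
def AMZSharp (n k : ℕ) : Prop := nuS n k = amzEstimate n k

/-- The shifted almost minimum zero estimate is sharp (shifted minimum zero cases included). -/
def SAMZSharp (n k : ℕ) : Prop := nuS n k = samzEstimate n k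

/-- Almost minimum zero case in the strict sense: the almost minimum zero estimate is sharp,
and it is not a minimum zero case. -/
def IsAMZC (n k : ℕ) : Prop := AMZSharp n k ∧ ¬ IsMZC n k

/-- Shifted almost minimum zero case in the strict sense: the shifted almost minimum zero
estimate is sharp, and it is not a shifted minimum zero case. -/
def IsSAMZC (n k : ℕ) : Prop := SAMZSharp n k ∧ ¬ IsSMZC n k

end StirlingTwo

/-!
Fix `n = c * 2 ^ h` and `1 ≤ k ≤ 2 ^ (h + 1)`. The digit side is short: subtracting `k` from `n`
loses exactly one of the binary digits of `n`, so the almost minimum zero estimate is always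
`sigma k - 1` (`amzEstimate_eq`). By Legendre's formula the estimate says that `k! S(n,k)` is
divisible by `2 ^ (k - 1)`, and it is sharp exactly if the quotient is odd.

To find that quotient modulo two, start from the alternating sum of `(k choose i) * i ^ n`
over `i ≤ k`. As `n > k`, the even `i` contribute a multiple of `2 ^ k`, which does not affect
the parity of the quotient. For odd `i = 2 * s + 1` expand `(1 + 2 * s) ^ n` in
the functions `newton r`, `s ↦ 4 ^ r * (s choose r)`. This basis fits the problem, because the sum
of `newton r` against the odd places of row `k` is `2 ^ (k - 1) * (k - 1 - r choose r)`
(`four_pow_mul_sum_choose_odd`). So only the parities of the coefficients are needed.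

The integer span of the `newton r` is a ring, and modulo two it is a divided power algebra, in which
elements without constant term have square zero (`isTwice_newton_mul_sub`, `isTwice_sum_newton_sq`).
The function `(1 + 2 * s) ^ (2 ^ h)` lies in it except for its leading term, which is half an odd
multiple of `newton (2 ^ h)`. Repeated squaring therefore gives, modulo two,
`(1 + 2 * s) ^ (2 ^ h) = 1 + ∑ newton (2 ^ h - 2 ^ j) + leading term`, summed over `1 ≤ j < h`
(`exists_one_add_two_mul_pow`). The leading term vanishes for the relevant `s < 2 ^ h`, and without
it the function has square one modulo two, so raising to the odd power `c` has no effect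
(`exists_one_add_two_mul_pow_of_odd`).

Consequently the quotient is congruent to `1 + ∑ (k - 1 - r_j choose r_j)` with
`r_j = 2 ^ h - 2 ^ j`. By Lucas' theorem the `j`-th summand is odd exactly if
`2 ^ j ≤ 2 ^ (h + 1) - k < 2 ^ (j + 1)`, so the sum is odd exactly if `2 ≤ 2 ^ (h + 1) - k < 2 ^ h`
(`sum_choose_two_pow_sub_cast`). Hence the estimate is sharp for `k ≤ 2 ^ h` and for the two values
`k = 2 ^ (h + 1) - 1` and `k = 2 ^ (h + 1)`, and for no other `k` in the range.
-/

namespace StirlingTwo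

/-! ### Stirling numbers and alternating power sums -/

/-- The explicit formula for Stirling numbers of the second kind. -/
theorem sum_alternating_choose_mul_pow (n : ℕ) : ∀ k : ℕ,
    ∑ i ∈ Finset.range (k + 1), (-1 : ℤ) ^ (k + i) * (k.choose i : ℤ) * (i : ℤ) ^ n =
      (k.factorial * n.stirlingSecond k : ℕ) := by
  induction n with
  | zero =>
    intro k
    have h := Int.alternating_sum_range_choose (n := k)
    have : ∑ i ∈ Finset.range (k + 1), (-1 : ℤ) ^ (k + i) * (k.choose i : ℤ) * (i : ℤ) ^ 0 =
        (-1) ^ k * ∑ i ∈ Finset.range (k + 1), (-1 : ℤ) ^ i * (k.choose i : ℤ) := by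
      rw [Finset.mul_sum]
      exact Finset.sum_congr rfl fun i _ => by ring
    rw [this, h]
    cases k <;> simp
  | succ n ih =>
    intro k
    cases k with
    | zero => simp
    | succ k =>
      have h1 := ih (k + 1)
      have h2 := ih k
      have key : ∑ i ∈ Finset.range (k + 1 + 1),
          (-1 : ℤ) ^ (k + 1 + i) * ((k + 1).choose i : ℤ) * (i : ℤ) ^ (n + 1) =
          (k + 1) * (∑ i ∈ Finset.range (k + 1 + 1),
            (-1 : ℤ) ^ (k + 1 + i) * ((k + 1).choose i : ℤ) * (i : ℤ) ^ n +
          ∑ i ∈ Finset.range (k + 1 + 1), (-1 : ℤ) ^ (k + i) * (k.choose i : ℤ) * (i : ℤ) ^ n) := by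
        rw [← Finset.sum_add_distrib, Finset.mul_sum]
        refine Finset.sum_congr rfl fun i _ => ?_
        cases i with
        | zero => simp; right; ring
        | succ i =>
          have e1 : ((k + 1).choose (i + 1) : ℤ) * (i + 1) = (k + 1) * (k.choose i : ℤ) := by
            exact_mod_cast (Nat.add_one_mul_choose_eq k i).symm
          have e2 : ((k + 1).choose (i + 1) : ℤ) = k.choose i + k.choose (i + 1) := by
            exact_mod_cast Nat.choose_succ_succ k i
          push_cast
          linear_combination (-1) ^ (k + 1 + (i + 1)) * ((i : ℤ) + 1) ^ n * e1 -
            (k + 1) * (-1) ^ (k + 1 + (i + 1)) * ((i : ℤ) + 1) ^ n * e2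
      rw [key, h1, Finset.sum_range_succ _ (k + 1), h2, Nat.stirlingSecond_succ_succ,
        Nat.factorial_succ]
      simp
      ring

theorem sum_range_two_mul {M : Type*} [AddCommMonoid M] (g : ℕ → M) (m : ℕ) :
    ∑ i ∈ Finset.range (2 * m), g i = ∑ s ∈ Finset.range m, (g (2 * s) + g (2 * s + 1)) := by
  induction m with
  | zero => simp
  | succ m ih =>
    rw [Finset.sum_range_succ, ← ih, show 2 * (m + 1) = 2 * m + 1 + 1 by ring,
      Finset.sum_range_succ, Finset.sum_range_succ, add_assoc]

/-- `k! S(n,k)` split into the contributions of the even and of the odd bases. -/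
theorem factorial_mul_stirlingSecond (n k : ℕ) :
    ((k.factorial * n.stirlingSecond k : ℕ) : ℤ) =
      (-1) ^ k * (∑ s ∈ Finset.range (k + 1), (k.choose (2 * s) : ℤ) * (2 * s : ℤ) ^ n -
        ∑ s ∈ Finset.range (k + 1), (k.choose (2 * s + 1) : ℤ) * (1 + 2 * s : ℤ) ^ n) := by
  rw [← sum_alternating_choose_mul_pow,
    Finset.sum_subset (s₂ := Finset.range (2 * (k + 1)))
      (Finset.range_subset_range.2 (by omega)) ?_, sum_range_two_mul, ← Finset.sum_sub_distrib,
      Finset.mul_sum]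
  · refine Finset.sum_congr rfl fun s _ => ?_
    have : (-1 : ℤ) ^ (2 * s) = 1 := by simp
    push_cast
    rw [pow_add, pow_add, pow_succ, this]
    ring
  · intro i _ hi
    rw [Nat.choose_eq_zero_of_lt (by simpa using hi)]
    simp

/-! ### Binomial sums over the odd places -/

theorem sum_choose_odd_mul_choose_succ (k r m : ℕ) (hm : k < m) :
    ∑ s ∈ Finset.range (m + 1), (k + 2).choose (2 * s + 1) * s.choose (r + 1) =
      2 * ∑ s ∈ Finset.range (m + 1), (k + 1).choose (2 * s + 1) * s.choose (r + 1) +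
        ∑ s ∈ Finset.range (m + 1), k.choose (2 * s + 1) * s.choose r := by
  have odd_step (k r : ℕ) : ∑ s ∈ Finset.range (m + 1), (k + 1).choose (2 * s + 1) * s.choose r =
      ∑ s ∈ Finset.range (m + 1), k.choose (2 * s) * s.choose r +
      ∑ s ∈ Finset.range (m + 1), k.choose (2 * s + 1) * s.choose r := by
    rw [← Finset.sum_add_distrib]
    exact Finset.sum_congr rfl fun s _ => by rw [Nat.choose_succ_succ]; ring
  have even_step : ∑ s ∈ Finset.range (m + 1), (k + 1).choose (2 * s) * s.choose (r + 1) =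
      ∑ s ∈ Finset.range (m + 1), k.choose (2 * s) * s.choose (r + 1) +
      (∑ s ∈ Finset.range (m + 1), k.choose (2 * s + 1) * s.choose (r + 1) +
      ∑ s ∈ Finset.range (m + 1), k.choose (2 * s + 1) * s.choose r) := by
    rw [← Finset.sum_add_distrib, Finset.sum_range_succ', Finset.sum_range_succ' (n := m),
      Finset.sum_range_succ (n := m), Nat.choose_eq_zero_of_lt (show k < 2 * m + 1 by omega)]
    simp only [Nat.choose_zero_succ, mul_zero, add_zero, zero_mul]
    rw [← Finset.sum_add_distrib]
    refine Finset.sum_congr rfl fun s _ => ?_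
    rw [show 2 * (s + 1) = 2 * s + 1 + 1 by ring, Nat.choose_succ_succ k (2 * s + 1),
      Nat.choose_succ_succ s r]
    ring
  have h1 := odd_step (k + 1) (r + 1)
  have h2 := odd_step k (r + 1)
  rw [even_step] at h1
  rw [h1, h2]
  ring

/-- The sum of `newton r` against the odd places of row `k + 1` of Pascal's triangle is
`2 ^ k` times an integer. For `r > k` the truncated subtraction is harmless, since then
`(k - r).choose r = (0).choose r = 0`. -/
theorem four_pow_mul_sum_choose_odd (k : ℕ) : ∀ r m : ℕ, k < m →
    4 ^ r * ∑ s ∈ Finset.range (m + 1), (k + 1).choose (2 * s + 1) * s.choose r =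
      2 ^ k * (k - r).choose r := by
  induction k using Nat.strong_induction_on with
  | _ k ih =>
    intro r m hm
    cases r with
    | zero =>
      have h := Nat.sum_range_choose k
      rw [Finset.sum_subset (s₂ := Finset.range (2 * (m + 1)))
        (Finset.range_subset_range.2 (by omega)) (fun i _ hi =>
          Nat.choose_eq_zero_of_lt (by simpa using hi)), sum_range_two_mul] at h
      simp only [pow_zero, Nat.choose_zero_right, mul_one, one_mul]
      rw [← h]
      exact Finset.sum_congr rfl fun s _ => Nat.choose_succ_succ k (2 * s)
    | succ r =>
      rcases k with _ | _ | k
      · rw [Finset.sum_eq_zero]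
        · simp
        · intro s _
          rcases s with _ | s
          · simp
          · rw [Nat.choose_eq_zero_of_lt (by omega)]; simp
      · rw [Finset.sum_eq_zero]
        · simp
        · intro s _
          rcases s with _ | s
          · simp
          · rw [Nat.choose_eq_zero_of_lt (by omega)]; simp
      · have h1 := ih (k + 1) (by omega) (r + 1) m (by omega)
        have h2 := ih k (by omega) r m (by omega)
        rw [sum_choose_odd_mul_choose_succ (k + 1) r m (by omega), mul_add, mul_left_comm, h1,
          pow_succ 4, mul_right_comm, h2]
        have pascal : (k + 2 - (r + 1)).choose (r + 1) =
            (k - r).choose r + (k + 1 - (r + 1)).choose (r + 1) := by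
          rcases Nat.lt_or_ge k r with h | h
          · rw [Nat.choose_eq_zero_of_lt (by omega), Nat.choose_eq_zero_of_lt (by omega),
              Nat.choose_eq_zero_of_lt (by omega)]
          · rw [show k + 2 - (r + 1) = (k - r) + 1 by omega,
              show k + 1 - (r + 1) = k - r by omega, Nat.choose_succ_succ]
        rw [pascal]
        ring

/-! ### Parity of binomial coefficients -/

/-- Lucas' theorem, with the lowest `j` digits split off when those of the lower index vanish. -/
theorem choose_two_pow_mul_add_modEq (j : ℕ) : ∀ n m b : ℕ, b < 2 ^ j →
    (2 ^ j * n + b).choose (2 ^ j * m) ≡ n.choose m [MOD 2] := by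
  induction j with
  | zero => intro n m b hb; obtain rfl : b = 0 := by simpa using hb
            simpa using Nat.ModEq.refl _
  | succ j ih =>
    intro n m b hb
    have := Fact.mk Nat.prime_two
    have h := Choose.choose_modEq_choose_mod_mul_choose_div_nat (p := 2)
      (n := 2 ^ (j + 1) * n + b) (k := 2 ^ (j + 1) * m)
    have e1 : 2 ^ (j + 1) * m = 2 * (2 ^ j * m) := by ring
    have e2 : (2 ^ (j + 1) * n + b) / 2 = 2 ^ j * n + b / 2 := by
      rw [show 2 ^ (j + 1) * n = 2 * (2 ^ j * n) by ring]; omega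
    rw [e2, e1, Nat.mul_mod_right, Nat.choose_zero_right, one_mul,
      Nat.mul_div_cancel_left _ two_pos] at h
    rw [e1]
    exact h.trans (ih n m (b / 2) (by rw [pow_succ] at hb; omega))

/-- The binomial coefficient is odd exactly if `2 ^ (h + 1) - (k + 1)` lies in the dyadic interval
`[2 ^ j, 2 ^ (j + 1))`. -/
theorem choose_two_pow_sub_cast {h j k : ℕ} (hj : 1 ≤ j) (hjh : j < h) (hk : k + 1 ≤ 2 ^ (h + 1)) :
    (((k - (2 ^ h - 2 ^ j)).choose (2 ^ h - 2 ^ j) : ℕ) : ZMod 2) =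
      if Nat.log 2 (2 ^ (h + 1) - (k + 1)) = j then 1 else 0 := by
  obtain ⟨d, rfl⟩ : ∃ d, h = j + (d + 1) := ⟨h - j - 1, by omega⟩
  have hd : 0 < 2 ^ d := by positivity
  have hj0 : 0 < 2 ^ j := by positivity
  have hpos : 2 ^ j * 1 ≤ 2 ^ j * 2 ^ d := Nat.mul_le_mul_left _ hd
  have eh : 2 ^ (j + (d + 1)) = 2 * (2 ^ j * 2 ^ d) := by ring
  have eh1 : 2 ^ (j + (d + 1) + 1) = 4 * (2 ^ j * 2 ^ d) := by ring
  have er : 2 ^ (j + (d + 1)) - 2 ^ j = 2 ^ j * (2 ^ (d + 1) - 1) := by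
    rw [Nat.mul_sub, pow_add]; simp
  have hlog := @Nat.log_eq_iff 2 j (2 ^ (j + (d + 1) + 1) - (k + 1)) (Or.inl (by omega))
  have ej1 : 2 ^ (j + 1) = 2 * 2 ^ j := by ring
  rw [eh1, ej1] at hlog
  rw [eh1] at hk ⊢
  have cast_of {a b : ℕ} (hab : a ≡ b [MOD 2]) : (a : ZMod 2) = b :=
    (ZMod.natCast_eq_natCast_iff _ _ _).2 hab
  by_cases c1 : 4 * (2 ^ j * 2 ^ d) - (k + 1) < 2 * 2 ^ j
  · by_cases c2 : 2 ^ j ≤ 4 * (2 ^ j * 2 ^ d) - (k + 1)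
    · rw [if_pos (hlog.2 ⟨c2, c1⟩)]
      have e : k - (2 ^ (j + (d + 1)) - 2 ^ j) = 2 ^ j * (2 ^ (d + 1) - 1) +
          (2 * 2 ^ j - 1 - (4 * (2 ^ j * 2 ^ d) - (k + 1))) := by
        rw [← er]; omega
      rw [e, er, cast_of (choose_two_pow_mul_add_modEq j _ _ _ (by omega))]
      simp
    · rw [if_neg fun hh => c2 (hlog.1 hh).1]
      have e : k - (2 ^ (j + (d + 1)) - 2 ^ j) = 2 ^ j * 2 ^ (d + 1) +
          (2 ^ j - 1 - (4 * (2 ^ j * 2 ^ d) - (k + 1))) := by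
        rw [← pow_add]; omega
      rw [e, er, cast_of (choose_two_pow_mul_add_modEq j _ _ _ (by omega))]
      have : 2 ^ (d + 1) = (2 ^ (d + 1) - 1) + 1 := by
        have : 0 < 2 ^ (d + 1) := by positivity
        omega
      rw [this, Nat.add_sub_cancel, Nat.choose_succ_self_right, ← this, pow_succ]
      push_cast
      rw [show (2 : ZMod 2) = 0 from rfl, mul_zero]
  · rw [if_neg fun hh => c1 (hlog.1 hh).2, Nat.choose_eq_zero_of_lt (by omega), Nat.cast_zero]

/-- The dyadic intervals `[2 ^ j, 2 ^ (j + 1))` with `1 ≤ j < h` partition `[2, 2 ^ h)`, so at most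
one summand is odd. -/
theorem sum_choose_two_pow_sub_cast {h k : ℕ} (hk : k + 1 ≤ 2 ^ (h + 1)) :
    ((∑ j ∈ Finset.Ico 1 h, (k - (2 ^ h - 2 ^ j)).choose (2 ^ h - 2 ^ j) : ℕ) : ZMod 2) =
      if 2 ≤ 2 ^ (h + 1) - (k + 1) ∧ 2 ^ (h + 1) - (k + 1) < 2 ^ h then 1 else 0 := by
  rw [Nat.cast_sum, Finset.sum_congr rfl fun j hj => choose_two_pow_sub_cast
    (Finset.mem_Ico.1 hj).1 (Finset.mem_Ico.1 hj).2 hk, Finset.sum_ite_eq]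
  refine if_congr ?_ rfl rfl
  generalize 2 ^ (h + 1) - (k + 1) = m
  rw [Finset.mem_Ico]
  have h1 : 1 ≤ Nat.log 2 m ↔ 2 ≤ m := by
    rw [Nat.one_le_iff_ne_zero, Ne, Nat.log_eq_zero_iff]; omega
  rw [h1]
  refine and_congr_right fun hm => ?_
  exact Nat.log_lt_iff_lt_pow (by norm_num) (by omega)

/-! ### The lattice spanned by scaled binomial coefficients -/

/-- The scaled Newton basis function `s ↦ 4 ^ r * (s choose r)`. -/
def newton (r : ℕ) : ℕ → ℤ := fun s => 4 ^ r * (s.choose r : ℤ)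

/-- The integer span of the functions `newton r`; it is closed under multiplication, see
`mul_mem_newtonLattice`. -/
def newtonLattice : AddSubgroup (ℕ → ℤ) := AddSubgroup.closure (Set.range newton)

theorem newton_mem (r : ℕ) : newton r ∈ newtonLattice :=
  AddSubgroup.subset_closure ⟨r, rfl⟩

theorem newton_zero : newton 0 = 1 := by
  funext s; simp [newton]

theorem one_mem_newtonLattice : (1 : ℕ → ℤ) ∈ newtonLattice := newton_zero ▸ newton_mem 0

theorem intCast_mul_mem {f : ℕ → ℤ} (hf : f ∈ newtonLattice) (a : ℤ) :
    (a : ℕ → ℤ) * f ∈ newtonLattice := by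
  rw [← zsmul_eq_mul]; exact newtonLattice.zsmul_mem hf a

theorem choose_mul_choose (s i j : ℕ) :
    s.choose i * s.choose j = ∑ t ∈ Finset.range (j + 1),
      (i + j - t).choose i * i.choose t * s.choose (i + j - t) := by
  rcases Nat.lt_or_ge s i with h | h
  · rw [Nat.choose_eq_zero_of_lt h, zero_mul, Finset.sum_eq_zero]
    intro t ht
    have := Finset.mem_range.1 ht
    rw [Nat.choose_eq_zero_of_lt (show s < i + j - t by omega), mul_zero]
  · conv_lhs => rw [show s.choose j = (i + (s - i)).choose j by rw [Nat.add_sub_cancel' h]]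
    rw [Nat.add_choose_eq, Finset.Nat.sum_antidiagonal_eq_sum_range_succ_mk, Finset.mul_sum]
    refine Finset.sum_congr rfl fun t ht => ?_
    have := Finset.mem_range.1 ht
    have h1 := Nat.choose_mul (n := s) (k := i + j - t) (s := i) (by omega)
    rw [show i + j - t - i = j - t by omega] at h1
    dsimp only
    rw [mul_left_comm, ← h1]
    ring

theorem newton_mul_newton (i j : ℕ) :
    newton i * newton j = ∑ t ∈ Finset.range (j + 1),
      ((4 ^ t * ((i + j - t).choose i * i.choose t) : ℕ) : ℕ → ℤ) * newton (i + j - t) := by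
  funext s
  have h : (s.choose i * s.choose j : ℤ) = ∑ t ∈ Finset.range (j + 1),
      ((i + j - t).choose i * i.choose t * s.choose (i + j - t) : ℤ) := by
    exact_mod_cast choose_mul_choose s i j
  simp only [newton, Pi.mul_apply, Finset.sum_apply, Pi.natCast_apply]
  rw [mul_mul_mul_comm, h, Finset.mul_sum]
  refine Finset.sum_congr rfl fun t ht => ?_
  have e : (4 : ℤ) ^ i * 4 ^ j = 4 ^ t * 4 ^ (i + j - t) := by
    rw [← pow_add, ← pow_add]
    congr 1
    have := Finset.mem_range.1 ht
    omega
  rw [e]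
  push_cast
  ring

theorem mul_mem_newtonLattice {f g : ℕ → ℤ} (hf : f ∈ newtonLattice) (hg : g ∈ newtonLattice) :
    f * g ∈ newtonLattice := by
  induction hf, hg using AddSubgroup.closure_induction₂ with
  | mem x y hx hy =>
    obtain ⟨i, rfl⟩ := hx
    obtain ⟨j, rfl⟩ := hy
    rw [newton_mul_newton]
    refine newtonLattice.sum_mem fun t _ => ?_
    exact_mod_cast intCast_mul_mem (newton_mem _) _
  | zero_left x hx => rw [zero_mul]; exact newtonLattice.zero_mem
  | zero_right x hx => rw [mul_zero]; exact newtonLattice.zero_mem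
  | add_left x y z _ _ _ h1 h2 => rw [add_mul]; exact newtonLattice.add_mem h1 h2
  | add_right x y z _ _ _ h1 h2 => rw [mul_add]; exact newtonLattice.add_mem h1 h2
  | neg_left x y _ _ h => rw [neg_mul]; exact newtonLattice.neg_mem h
  | neg_right x y _ _ h => rw [mul_neg]; exact newtonLattice.neg_mem h

/-- `f` is twice an element of `newtonLattice`; congruence modulo two in the lattice is
`IsTwice (f - g)`. -/
def IsTwice (f : ℕ → ℤ) : Prop := ∃ z ∈ newtonLattice, f = 2 * z

theorem isTwice_two_mul {z : ℕ → ℤ} (hz : z ∈ newtonLattice) : IsTwice (2 * z) := ⟨z, hz, rfl⟩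

theorem IsTwice.add {f g : ℕ → ℤ} (hf : IsTwice f) (hg : IsTwice g) : IsTwice (f + g) := by
  obtain ⟨y, hy, rfl⟩ := hf
  obtain ⟨z, hz, rfl⟩ := hg
  exact ⟨y + z, newtonLattice.add_mem hy hz, by ring⟩

theorem IsTwice.mul {f g : ℕ → ℤ} (hf : f ∈ newtonLattice) (hg : IsTwice g) :
    IsTwice (f * g) := by
  obtain ⟨z, hz, rfl⟩ := hg
  exact ⟨f * z, mul_mem_newtonLattice hf hz, by ring⟩

theorem isTwice_zero : IsTwice 0 := ⟨0, newtonLattice.zero_mem, by simp⟩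

theorem isTwice_sum {ι : Type*} (s : Finset ι) (f : ι → ℕ → ℤ) (h : ∀ i ∈ s, IsTwice (f i)) :
    IsTwice (∑ i ∈ s, f i) :=
  Finset.sum_induction f IsTwice (fun _ _ => IsTwice.add) isTwice_zero h

theorem isTwice_even_mul {f : ℕ → ℤ} (hf : f ∈ newtonLattice) {a : ℤ} (ha : Even a) :
    IsTwice ((a : ℕ → ℤ) * f) := by
  obtain ⟨b, rfl⟩ := ha
  exact ⟨b * f, intCast_mul_mem hf b, by push_cast; ring⟩

/-- Modulo two the lattice is a divided power algebra with divided powers `newton r`. -/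
theorem isTwice_newton_mul_sub (i j : ℕ) :
    IsTwice (newton i * newton j - (((i + j).choose i : ℕ) : ℕ → ℤ) * newton (i + j)) := by
  rw [newton_mul_newton, Finset.sum_range_succ']
  simp only [pow_zero, Nat.choose_zero_right, mul_one, one_mul, tsub_zero, add_sub_cancel_right]
  refine isTwice_sum _ _ fun t _ => ?_
  have := isTwice_even_mul (newton_mem (i + j - (t + 1)))
    (a := ((4 ^ (t + 1) * ((i + j - (t + 1)).choose i * i.choose (t + 1)) : ℕ) : ℤ)) (by
      rw [pow_succ]; push_cast
      exact (even_iff_two_dvd.2 ⟨4 ^ t * 2, by ring⟩ : Even ((4 : ℤ) ^ t * 4)).mul_right _)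
  exact_mod_cast this

theorem isTwice_newton_mul_self {i : ℕ} (hi : 0 < i) : IsTwice (newton i * newton i) := by
  have h := isTwice_newton_mul_sub i i
  have h2 : Even (((i + i).choose i : ℕ) : ℤ) := by
    have := Nat.two_dvd_centralBinom_of_one_le hi
    rw [Nat.centralBinom_eq_two_mul_choose, two_mul] at this
    exact_mod_cast even_iff_two_dvd.2 this
  have := h.add (isTwice_even_mul (newton_mem (i + i)) h2)
  simpa using this

theorem isTwice_sum_newton_sq (s : Finset ℕ) (r : ℕ → ℕ) (hr : ∀ j ∈ s, 0 < r j) :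
    IsTwice ((∑ j ∈ s, newton (r j)) * ∑ j ∈ s, newton (r j)) := by
  induction s using Finset.induction_on with
  | empty => simpa using isTwice_zero
  | insert a s ha ih =>
    rw [Finset.sum_insert ha]
    have h1 := ih fun j hj => hr j (Finset.mem_insert_of_mem hj)
    have h2 := isTwice_newton_mul_self (hr a (Finset.mem_insert_self a s))
    have h3 := isTwice_two_mul (mul_mem_newtonLattice (newton_mem (r a))
      (newtonLattice.sum_mem (t := s) fun j _ => newton_mem (r j)))
    convert (h1.add h2).add h3 using 1
    ring

/-! ### Powers of an odd number in the Newton basis -/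

/-- The sum of the `newton r`, `0 < r < 2 ^ h`, that have an odd coefficient in
`s ↦ (1 + 2 * s) ^ (2 ^ h)`: the `r` that occur are `2 ^ h - 2 ^ j` with `1 ≤ j < h`. -/
def oddPart (h : ℕ) : ℕ → ℤ := ∑ j ∈ Finset.Ico 1 h, newton (2 ^ h - 2 ^ j)

/-- The leading term `(2 ^ h)! * 2 ^ (2 ^ h) * (s choose 2 ^ h)` of
`(1 + 2 * s) ^ (2 ^ h)` in the Newton basis. -/
def leadingTerm (h : ℕ) : ℕ → ℤ :=
  fun s => ((2 ^ h).factorial * 2 ^ (2 ^ h) : ℕ) * (s.choose (2 ^ h) : ℤ)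

theorem oddPart_mem (h : ℕ) : oddPart h ∈ newtonLattice :=
  newtonLattice.sum_mem fun _ _ => newton_mem _

theorem two_pow_lt_two_pow_of_mem {h j : ℕ} (hj : j ∈ Finset.Ico 1 h) : 2 ^ j < 2 ^ h :=
  Nat.pow_lt_pow_right (by norm_num) (Finset.mem_Ico.1 hj).2

theorem isTwice_oddPart_sq (h : ℕ) : IsTwice (oddPart h * oddPart h) :=
  isTwice_sum_newton_sq _ _ fun _ hj => Nat.sub_pos_of_lt (two_pow_lt_two_pow_of_mem hj)

theorem exists_odd_factorial_two_pow (h : ℕ) :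
    ∃ o : ℕ, Odd o ∧ 2 * (2 ^ h).factorial = o * 2 ^ (2 ^ h) := by
  induction h with
  | zero => exact ⟨1, odd_one, by simp⟩
  | succ h ih =>
    obtain ⟨o, ho, e⟩ := ih
    have hN : 0 < 2 ^ h := by positivity
    have hc : (2 ^ h + 2 ^ h).choose (2 ^ h) * (2 ^ h).factorial * (2 ^ h).factorial =
        (2 ^ h + 2 ^ h).factorial := Nat.add_choose_mul_factorial_mul_factorial _ _
    have hc2 : (2 ^ h + 2 ^ h).choose (2 ^ h) = 2 * (2 ^ h + (2 ^ h - 1)).choose (2 ^ h) := by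
      obtain ⟨m, hm⟩ : ∃ m, 2 ^ h = m + 1 := ⟨2 ^ h - 1, by omega⟩
      rw [hm, Nat.add_sub_cancel, ← add_assoc, Nat.choose_succ_succ, two_mul,
        Nat.choose_symm_add (a := m + 1) (b := m), add_comm]
    have hodd : Odd ((2 ^ h + (2 ^ h - 1)).choose (2 ^ h)) := by
      have := choose_two_pow_mul_add_modEq h 1 1 (2 ^ h - 1) (by omega)
      simp only [mul_one, Nat.choose_self] at this
      exact Nat.odd_iff.2 this
    refine ⟨_, (hodd.mul ho).mul ho, ?_⟩
    have e2 : 2 ^ (h + 1) = 2 ^ h + 2 ^ h := by ring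
    rw [e2, ← hc, hc2, pow_add]
    linear_combination ((2 ^ h + (2 ^ h - 1)).choose (2 ^ h) : ℕ) *
      (2 * (2 ^ h).factorial + o * 2 ^ 2 ^ h) * e

/-- The leading term lies just outside the lattice: it is half an odd multiple of
`newton (2 ^ h)`. -/
theorem exists_odd_two_mul_leadingTerm (h : ℕ) :
    ∃ o : ℤ, Odd o ∧ 2 * leadingTerm h = (o : ℕ → ℤ) * newton (2 ^ h) := by
  obtain ⟨o, ho, e⟩ := exists_odd_factorial_two_pow h
  refine ⟨o, by exact_mod_cast ho, ?_⟩
  funext s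
  have e' : (2 * (2 ^ h).factorial : ℤ) = o * 2 ^ (2 ^ h) := by exact_mod_cast e
  have e4 : (4 : ℤ) ^ (2 ^ h) = 2 ^ (2 ^ h) * 2 ^ (2 ^ h) := by rw [← mul_pow]; norm_num
  simp only [Pi.mul_apply, leadingTerm, newton, Pi.ofNat_apply, Pi.intCast_apply, e4]
  push_cast
  linear_combination (2 ^ (2 ^ h) * (s.choose (2 ^ h) : ℤ)) * e'

/-- The product `newton (2 ^ h) * newton (2 ^ h)` has to be known modulo eight here, because the
square of the leading term is a quarter of an odd multiple of it. -/
theorem isTwice_leadingTerm_sq_sub {h : ℕ} (hh : 1 ≤ h) :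
    IsTwice (leadingTerm h * leadingTerm h - leadingTerm (h + 1)) := by
  obtain ⟨o, -, e⟩ := exists_odd_two_mul_leadingTerm h
  have hN : Even (2 ^ h) := (Nat.even_pow.2 ⟨even_two, by omega⟩)
  have hcoef (t : ℕ) : ∃ b : ℕ, 4 ^ t * ((2 ^ h + 2 ^ h - (t + 1)).choose (2 ^ h) *
      (2 ^ h).choose (t + 1)) = 2 * b := by
    rw [← dvd_def]
    rcases t with _ | t
    · rw [zero_add, Nat.choose_one_right]
      exact ((even_iff_two_dvd.1 hN).mul_left _).mul_left _
    · exact ((show 2 ∣ 4 by norm_num).trans (dvd_pow_self 4 (by omega))).mul_right _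
  choose b hb using hcoef
  -- `4 * f` is compared below instead of `f`, so that the halves in the leading terms disappear.
  refine ⟨∑ t ∈ Finset.range (2 ^ h), ((o ^ 2 * b t : ℤ) : ℕ → ℤ) *
    newton (2 ^ h + 2 ^ h - (t + 1)), newtonLattice.sum_mem fun t _ =>
      intCast_mul_mem (newton_mem _) _, ?_⟩
  have top : 4 * leadingTerm (h + 1) = (o ^ 2 * ((2 ^ h + 2 ^ h).choose (2 ^ h) : ℕ) : ℕ → ℤ) *
      newton (2 ^ h + 2 ^ h) := by
    have hc : ((2 ^ h + 2 ^ h).choose (2 ^ h) * (2 ^ h).factorial * (2 ^ h).factorial : ℤ) =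
        (2 ^ h + 2 ^ h).factorial := by
      exact_mod_cast Nat.add_choose_mul_factorial_mul_factorial (2 ^ h) (2 ^ h)
    have e1 := congrFun e (2 ^ h)
    have e4 : (4 : ℤ) ^ (2 ^ h) = 2 ^ (2 ^ h) * 2 ^ (2 ^ h) := by rw [← mul_pow]; norm_num
    simp only [Pi.mul_apply, leadingTerm, newton, Pi.ofNat_apply, Pi.intCast_apply, e4,
      Nat.choose_self] at e1
    push_cast at e1
    have e2 : 2 ^ (h + 1) = 2 ^ h + 2 ^ h := by ring
    funext s
    simp only [leadingTerm, newton, e2, Pi.mul_apply, Pi.pow_apply, Pi.intCast_apply,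
      Pi.natCast_apply, Pi.ofNat_apply]
    push_cast
    rw [← hc, pow_add, pow_add, e4]
    linear_combination (s.choose (2 ^ h + 2 ^ h) * (2 ^ h + 2 ^ h).choose (2 ^ h) : ℤ) *
      (2 * ((2 ^ h).factorial * 2 ^ 2 ^ h) + o * (2 ^ 2 ^ h * 2 ^ 2 ^ h)) * e1
  have hsq : 4 * (leadingTerm h * leadingTerm h) =
      (o ^ 2 : ℕ → ℤ) * (newton (2 ^ h) * newton (2 ^ h)) := by
    linear_combination (2 * leadingTerm h + o * newton (2 ^ h)) * e
  have hmain : 4 * (leadingTerm h * leadingTerm h - leadingTerm (h + 1)) =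
      4 * (2 * ∑ t ∈ Finset.range (2 ^ h), ((o ^ 2 * b t : ℤ) : ℕ → ℤ) *
        newton (2 ^ h + 2 ^ h - (t + 1))) := by
    rw [mul_sub, hsq, top, newton_mul_newton, Finset.sum_range_succ', mul_add]
    simp only [pow_zero, Nat.choose_zero_right, mul_one, one_mul, tsub_zero]
    rw [mul_assoc, add_sub_cancel_right, Finset.mul_sum, Finset.mul_sum, Finset.mul_sum]
    refine Finset.sum_congr rfl fun t _ => ?_
    rw [pow_succ 4, mul_right_comm, hb]
    push_cast
    ring
  funext s
  have := congrFun hmain s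
  simp only [Pi.mul_apply, Pi.ofNat_apply] at this ⊢
  linarith

/-- Doubling `2 ^ h` turns each index `2 ^ h - 2 ^ j` into `2 ^ (h + 1) - 2 ^ j`, and the leading
term supplies the new index `2 ^ h = 2 ^ (h + 1) - 2 ^ h`. -/
theorem isTwice_newton_mul_oddPart {h : ℕ} (hh : 1 ≤ h) :
    IsTwice (newton (2 ^ h) + newton (2 ^ h) * oddPart h - oddPart (h + 1)) := by
  have hN : 2 ^ (h + 1) = 2 ^ h + 2 ^ h := by ring
  have e : newton (2 ^ h) + newton (2 ^ h) * oddPart h - oddPart (h + 1) =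
      ∑ j ∈ Finset.Ico 1 h, (newton (2 ^ h) * newton (2 ^ h - 2 ^ j) -
        newton (2 ^ h + (2 ^ h - 2 ^ j))) := by
    have : ∀ j ∈ Finset.Ico 1 h, newton (2 ^ h + (2 ^ h - 2 ^ j)) = newton (2 ^ (h + 1) - 2 ^ j) :=
      fun j hj => by
        rw [hN, Nat.add_sub_assoc (two_pow_lt_two_pow_of_mem hj).le]
    rw [Finset.sum_sub_distrib, Finset.sum_congr rfl this, oddPart, oddPart,
      Finset.sum_Ico_succ_top hh, Finset.mul_sum, hN, Nat.add_sub_cancel]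
    ring
  rw [e]
  refine isTwice_sum _ _ fun j hj => ?_
  have hj' := two_pow_lt_two_pow_of_mem hj
  have hj0 : 0 < 2 ^ j := by positivity
  have h1 := isTwice_newton_mul_sub (2 ^ h) (2 ^ h - 2 ^ j)
  have hodd : Odd (((2 ^ h + (2 ^ h - 2 ^ j)).choose (2 ^ h) : ℕ) : ℤ) := by
    have := choose_two_pow_mul_add_modEq h 1 1 (2 ^ h - 2 ^ j) (by omega)
    simp only [mul_one, Nat.choose_self] at this
    exact_mod_cast Nat.odd_iff.2 this
  convert h1.add (isTwice_even_mul (newton_mem (2 ^ h + (2 ^ h - 2 ^ j)))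
    (hodd.sub_odd odd_one)) using 1
  push_cast
  ring

/-- The induction squares the expansion. Squares of elements of the lattice without constant term
vanish modulo two, so what survives comes from the leading term: its double, its square, and twice
its product with `oddPart h`. -/
theorem exists_one_add_two_mul_pow {h : ℕ} (hh : 1 ≤ h) : ∃ z ∈ newtonLattice,
    (fun s : ℕ => (1 + 2 * s : ℤ) ^ 2 ^ h) = 1 + oddPart h + 2 * z + leadingTerm h := by
  induction h, hh using Nat.le_induction with
  | base =>
    refine ⟨newton 1, newton_mem 1, ?_⟩
    funext s
    have h2 : (s * (s - 1) : ℤ) = 2 * (s.choose 2 : ℤ) := by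
      apply Int.cast_injective (α := ℚ)
      push_cast
      rw [Nat.cast_choose_two]
      ring
    simp [oddPart, newton, leadingTerm]
    linear_combination 4 * h2
  | succ h hh ih =>
    obtain ⟨z, hz, e⟩ := ih
    obtain ⟨o, ho, e2⟩ := exists_odd_two_mul_leadingTerm h
    have hA := oddPart_mem h
    have hf := newton_mem (2 ^ h)
    have hfA := mul_mem_newtonLattice hf hA
    suffices hs : IsTwice ((fun s : ℕ => (1 + 2 * s : ℤ) ^ 2 ^ (h + 1)) -
        (1 + oddPart (h + 1) + leadingTerm (h + 1))) by
      obtain ⟨y, hy, ey⟩ := hs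
      exact ⟨y, hy, by linear_combination ey⟩
    have esq : (fun s : ℕ => (1 + 2 * s : ℤ) ^ 2 ^ (h + 1)) =
        (1 + oddPart h + 2 * z + leadingTerm h) * (1 + oddPart h + 2 * z + leadingTerm h) := by
      rw [← e]; funext s; simp only [Pi.mul_apply]; ring
    have t1 := isTwice_two_mul (newtonLattice.add_mem hA (newtonLattice.add_mem hz
      (newtonLattice.add_mem hz (mul_mem_newtonLattice hz (newtonLattice.add_mem hA
        (newtonLattice.add_mem hA (newtonLattice.add_mem hz hz)))))))
    have t2 := isTwice_two_mul (intCast_mul_mem (mul_mem_newtonLattice hf hz) o)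
    have t3 := isTwice_even_mul (newtonLattice.add_mem hf hfA) (ho.sub_odd odd_one)
    convert ((((t1.add t2).add t3).add (isTwice_oddPart_sq h)).add
      (isTwice_leadingTerm_sq_sub hh)).add (isTwice_newton_mul_oddPart hh) using 1
    rw [esq]
    push_cast
    linear_combination (1 + oddPart h + 2 * z) * e2

/-- Restricting to `s < 2 ^ h` removes the leading term. What is left has square one modulo two, so
an odd exponent `c` changes nothing modulo two. -/
theorem exists_one_add_two_mul_pow_of_odd (h : ℕ) {c : ℕ} (hc : Odd c) : ∃ z ∈ newtonLattice,
    ∀ s : ℕ, s < 2 ^ h → (1 + 2 * s : ℤ) ^ (c * 2 ^ h) = 1 + oddPart h s + 2 * z s := by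
  rcases Nat.eq_zero_or_pos h with rfl | hh
  · refine ⟨0, newtonLattice.zero_mem, fun s hs => ?_⟩
    obtain rfl : s = 0 := by simpa using hs
    simp [oddPart]
  obtain ⟨z, hz, e⟩ := exists_one_add_two_mul_pow hh
  obtain ⟨d, rfl⟩ := hc
  have hA := oddPart_mem h
  have h1 := one_mem_newtonLattice
  set w : ℕ → ℤ := 1 + oddPart h + 2 * z with hw
  have hwm : w ∈ newtonLattice := newtonLattice.add_mem (newtonLattice.add_mem h1 hA)
    (by rw [two_mul]; exact newtonLattice.add_mem hz hz)
  have hsq : IsTwice (w * w - 1) := by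
    have t1 := isTwice_two_mul (newtonLattice.add_mem hA (newtonLattice.add_mem hz
      (newtonLattice.add_mem hz (mul_mem_newtonLattice hz (newtonLattice.add_mem hA
        (newtonLattice.add_mem hA (newtonLattice.add_mem hz hz)))))))
    convert t1.add (isTwice_oddPart_sq h) using 1
    rw [hw]; ring
  have hpow : IsTwice (w ^ (2 * d + 1) - w) := by
    induction d with
    | zero => simpa using isTwice_zero
    | succ d ih =>
      have hp : w ^ (2 * d + 1) ∈ newtonLattice := by
        obtain ⟨y, hy, ey⟩ := ih
        rw [sub_eq_iff_eq_add.1 ey, two_mul]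
        exact newtonLattice.add_mem (newtonLattice.add_mem hy hy) hwm
      convert ih.add (hsq.mul hp) using 1
      ring
  obtain ⟨y, hy, ey⟩ := hpow
  refine ⟨z + y, newtonLattice.add_mem hz hy, fun s hs => ?_⟩
  have e1 := congrFun e s
  have e2 := congrFun ey s
  simp only [hw, Pi.add_apply, Pi.sub_apply, Pi.mul_apply, Pi.pow_apply,
    Pi.ofNat_apply, leadingTerm, Nat.choose_eq_zero_of_lt hs, Nat.cast_zero, mul_zero,
    add_zero] at e1 e2 ⊢
  rw [mul_comm (2 * d + 1), pow_mul, e1]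
  linear_combination e2

/-! ### Binary digits -/

theorem sigma_two_mul_add {n b : ℕ} (hb : b < 2) : sigma (2 * n + b) = sigma n + b := by
  rcases Nat.eq_zero_or_pos (2 * n + b) with h | h
  · obtain rfl : n = 0 := by omega
    obtain rfl : b = 0 := by omega
    rfl
  · rw [sigma, Nat.digits_def' (by norm_num) h, List.sum_cons, show (2 * n + b) % 2 = b by omega,
      show (2 * n + b) / 2 = n by omega, sigma, add_comm]

theorem sigma_two_mul (n : ℕ) : sigma (2 * n) = sigma n := sigma_two_mul_add (b := 0) (by norm_num)

theorem sigma_zero : sigma 0 = 0 := by simp [sigma]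

theorem sigma_pos {n : ℕ} (hn : 0 < n) : 0 < sigma n := by
  induction n using Nat.strong_induction_on with
  | _ n ih =>
    obtain ⟨m, b, hb, rfl⟩ : ∃ m b, b < 2 ∧ n = 2 * m + b := ⟨n / 2, n % 2, by omega, by omega⟩
    rw [sigma_two_mul_add hb]
    rcases Nat.eq_zero_or_pos b with rfl | h
    · exact ih m (by omega) (by omega)
    · omega

theorem sigma_mul_two_pow_add (m : ℕ) : ∀ h b : ℕ, b < 2 ^ h →
    sigma (m * 2 ^ h + b) = sigma m + sigma b := by
  intro h
  induction h with
  | zero => intro b hb; obtain rfl : b = 0 := by simpa using hb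
            simp [sigma_zero]
  | succ h ih =>
    intro b hb
    obtain ⟨d, e, he, rfl⟩ : ∃ d e, e < 2 ∧ b = 2 * d + e := ⟨b / 2, b % 2, by omega, by omega⟩
    rw [show m * 2 ^ (h + 1) + (2 * d + e) = 2 * (m * 2 ^ h + d) + e by ring,
      sigma_two_mul_add he, sigma_two_mul_add he, ih d (by rw [pow_succ] at hb; omega), add_assoc]

theorem sigma_two_pow_sub_one (h : ℕ) : sigma (2 ^ h - 1) = h := by
  induction h with
  | zero => exact sigma_zero
  | succ h ih =>
    have : 0 < 2 ^ h := by positivity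
    rw [show 2 ^ (h + 1) - 1 = 2 * (2 ^ h - 1) + 1 by rw [pow_succ]; omega,
      sigma_two_mul_add (by norm_num), ih]

theorem sigma_two_pow (h : ℕ) : sigma (2 ^ h) = 1 := by
  induction h with
  | zero => simp [sigma]
  | succ h ih => rw [pow_succ, mul_comm, sigma_two_mul, ih]

theorem card_filter_testBit (m : ℕ) : ∀ n < 2 ^ m,
    ((Finset.range m).filter fun i => n.testBit i = true).card = sigma n := by
  induction m with
  | zero => intro n hn; obtain rfl : n = 0 := by simpa using hn
            simp [sigma_zero]
  | succ m ih =>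
    intro n hn
    obtain ⟨d, e, he, rfl⟩ : ∃ d e, e < 2 ∧ n = 2 * d + e := ⟨n / 2, n % 2, by omega, by omega⟩
    have h := ih d (by rw [pow_succ] at hn; omega)
    rw [Finset.card_filter] at h
    rw [sigma_two_mul_add he, ← h, Finset.card_filter, Finset.sum_range_succ']
    congr 1
    · refine Finset.sum_congr rfl fun i _ => ?_
      rw [Nat.testBit_succ, show (2 * d + e) / 2 = d by omega]
    · rw [Nat.testBit_zero]
      interval_cases e <;> simp

theorem mem_twoPowers {n i : ℕ} : 2 ^ i ∈ twoPowers n ↔ n.testBit i = true := by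
  simp only [twoPowers, Finset.mem_image, Finset.mem_filter, Finset.mem_range]
  constructor
  · rintro ⟨j, ⟨-, hj⟩, e⟩
    rwa [Nat.pow_right_injective le_rfl e] at hj
  · exact fun h => ⟨i, ⟨Nat.lt_two_pow_self.trans_le (Nat.ge_two_pow_of_testBit h), h⟩, rfl⟩

theorem card_twoPowers (n : ℕ) : (twoPowers n).card = sigma n := by
  rw [twoPowers, Finset.card_image_of_injective _ (Nat.pow_right_injective le_rfl),
    card_filter_testBit n n Nat.lt_two_pow_self]

theorem twoPowers_inter (m n : ℕ) : twoPowers m ∩ twoPowers n = twoPowers (m &&& n) := by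
  ext x
  by_cases hx : ∃ i, x = 2 ^ i
  · obtain ⟨i, rfl⟩ := hx
    simp [mem_twoPowers]
  · have (l : ℕ) : x ∉ twoPowers l := fun hm => by
      obtain ⟨i, -, e⟩ := Finset.mem_image.1 hm
      exact hx ⟨i, e.symm⟩
    simp [this]

theorem card_twoPowers_inter (m n : ℕ) :
    (twoPowers m ∩ twoPowers n).card = sigma (m &&& n) := by
  rw [twoPowers_inter, card_twoPowers]

theorem two_mul_add_land {a b x y : ℕ} (hx : x < 2) (hy : y < 2) :
    (2 * a + x) &&& (2 * b + y) = 2 * (a &&& b) + x * y := by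
  apply Nat.eq_of_testBit_eq
  intro i
  cases i with
  | zero =>
    simp only [Nat.testBit_zero]
    interval_cases x <;> interval_cases y <;> simp
  | succ i =>
    have hxy : x * y < 2 := by interval_cases x <;> interval_cases y <;> norm_num
    rw [Nat.testBit_land, Nat.testBit_succ, Nat.testBit_succ, Nat.testBit_succ,
      show (2 * a + x) / 2 = a by omega, show (2 * b + y) / 2 = b by omega,
      show (2 * (a &&& b) + x * y) / 2 = a &&& b by omega, Nat.testBit_land]

theorem mul_two_pow_land (a b : ℕ) : ∀ h x : ℕ, x < 2 ^ h →
    (a * 2 ^ h) &&& (b * 2 ^ h + x) = (a &&& b) * 2 ^ h := by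
  intro h
  induction h with
  | zero => intro x hx; obtain rfl : x = 0 := by simpa using hx
            simp
  | succ h ih =>
    intro x hx
    obtain ⟨d, e, he, rfl⟩ : ∃ d e, e < 2 ∧ x = 2 * d + e := ⟨x / 2, x % 2, by omega, by omega⟩
    rw [show a * 2 ^ (h + 1) = 2 * (a * 2 ^ h) + 0 by ring,
      show b * 2 ^ (h + 1) + (2 * d + e) = 2 * (b * 2 ^ h + d) + e by ring,
      two_mul_add_land (by norm_num) he, ih d (by rw [pow_succ] at hx; omega)]
    ring

theorem sigma_mul_two_pow (m h : ℕ) : sigma (m * 2 ^ h) = sigma m := by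
  simpa [sigma_zero] using sigma_mul_two_pow_add m h 0 (by positivity)

/-- Passing from `d + 1` to `d` removes exactly the lowest digit one and adds only digits that are
absent from `d + 1`. -/
theorem sigma_succ_land_self (d : ℕ) : sigma ((d + 1) &&& d) + 1 = sigma (d + 1) := by
  induction d using Nat.strong_induction_on with
  | _ d ih =>
    obtain ⟨m, rfl | rfl⟩ : ∃ m, d = 2 * m + 0 ∨ d = 2 * m + 1 := ⟨d / 2, by omega⟩
    · rw [add_zero, show (2 * m + 1) &&& (2 * m) = 2 * m by
        simpa using two_mul_add_land (a := m) (b := m) (x := 1) (y := 0) (by norm_num) (by norm_num),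
        sigma_two_mul, sigma_two_mul_add (by norm_num)]
    · rw [show 2 * m + 1 + 1 = 2 * (m + 1) + 0 by ring, two_mul_add_land (by norm_num) (by norm_num),
        zero_mul, add_zero, add_zero, sigma_two_mul, sigma_two_mul, ih m (by omega)]

/-- For `k` up to twice the 2-part of `n`, the estimate loses exactly one digit of `n`. -/
theorem amzEstimate_eq {c h k : ℕ} (hc : 3 ≤ c) (hodd : Odd c) (hk : 1 ≤ k)
    (hk2 : k ≤ 2 ^ (h + 1)) : amzEstimate (c * 2 ^ h) k = (sigma k : ℤ) - 1 := by
  obtain ⟨d, rfl⟩ : ∃ d, c = 2 * (d + 1) + 1 := by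
    obtain ⟨e, rfl⟩ := hodd
    exact ⟨e - 1, by omega⟩
  have hN : 0 < 2 ^ h := by positivity
  have key : sigma (((2 * (d + 1) + 1) * 2 ^ h) &&& ((2 * (d + 1) + 1) * 2 ^ h - k)) + 1 =
      sigma (2 * (d + 1) + 1) := by
    rw [sigma_two_mul_add (by norm_num)]
    rcases Nat.lt_or_ge (2 ^ h) k with h1 | h1
    · rw [show (2 * (d + 1) + 1) * 2 ^ h - k = (2 * d + 1) * 2 ^ h + (2 ^ (h + 1) - k) by
          rw [pow_succ] at hk2 ⊢; rw [add_mul, add_mul, mul_add, add_mul]; omega,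
        mul_two_pow_land _ _ h _ (by rw [pow_succ]; omega), sigma_mul_two_pow,
        two_mul_add_land (by norm_num) (by norm_num), sigma_two_mul_add (by norm_num),
        mul_one, sigma_succ_land_self]
    · rw [show (2 * (d + 1) + 1) * 2 ^ h - k = (2 * (d + 1) + 0) * 2 ^ h + (2 ^ h - k) by
          rw [add_mul, add_mul]; omega,
        mul_two_pow_land _ _ h _ (by omega), sigma_mul_two_pow,
        two_mul_add_land (by norm_num) (by norm_num), sigma_two_mul_add (by norm_num),
        mul_zero, add_zero, Nat.and_self]
  rw [amzEstimate, card_twoPowers_inter, sigma_mul_two_pow, ← key]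
  push_cast
  ring

theorem two_le_sigma {c : ℕ} (hc : 3 ≤ c) (hodd : Odd c) : 2 ≤ sigma c := by
  obtain ⟨e, rfl⟩ := hodd
  rw [sigma_two_mul_add (by norm_num)]
  have := sigma_pos (show 0 < e by omega)
  omega

theorem smzEstimate_two_pow {c h : ℕ} (hc : 3 ≤ c) (hodd : Odd c) :
    smzEstimate (c * 2 ^ h) (2 ^ (h + 1)) = 2 - (sigma c : ℤ) := by
  obtain ⟨e, rfl⟩ := hodd
  have hN : 0 < 2 ^ h := by positivity
  rw [smzEstimate, sigma_two_pow_sub_one,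
    show (2 * e + 1) * 2 ^ h - 1 = (2 * e) * 2 ^ h + (2 ^ h - 1) by rw [add_mul]; omega,
    sigma_mul_two_pow_add _ _ _ (by omega), sigma_two_pow_sub_one, sigma_two_mul,
    sigma_two_mul_add (by norm_num)]
  push_cast
  ring

theorem samzEstimate_two_pow {c h : ℕ} (hc : 3 ≤ c) (hodd : Odd c) :
    samzEstimate (c * 2 ^ h) (2 ^ (h + 1)) = 0 := by
  have hs := smzEstimate_two_pow (h := h) hc hodd
  rw [smzEstimate] at hs
  rw [samzEstimate, hs, card_twoPowers_inter]
  obtain ⟨d, rfl⟩ : ∃ d, c = 2 * (d + 1) + 1 := by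
    obtain ⟨e, rfl⟩ := hodd
    exact ⟨e - 1, by omega⟩
  have hN : 0 < 2 ^ h := by positivity
  have e1 : (2 * (d + 1) + 1) * 2 ^ h - 1 = (2 * (d + 1) + 0) * 2 ^ h + (2 ^ h - 1) := by
    rw [add_mul, add_mul]; omega
  have e2 : (2 * (d + 1) + 1) * 2 ^ h - 2 ^ (h + 1) = (2 * d + 1) * 2 ^ h := by
    rw [pow_succ, add_mul, add_mul, mul_add, add_mul]; omega
  rw [e1, e2, Nat.land_comm, mul_two_pow_land _ _ h _ (by omega), sigma_mul_two_pow,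
    two_mul_add_land (by norm_num) (by norm_num), Nat.land_comm, mul_zero, add_zero, sigma_two_mul,
    sigma_two_mul_add (by norm_num), ← sigma_succ_land_self d]
  push_cast
  ring

/-! ### The 2-adic size of `k! S(n,k)` -/

theorem exists_sum_choose_odd_mul {k m : ℕ} (hm : k < m) {z : ℕ → ℤ} (hz : z ∈ newtonLattice) :
    ∃ w : ℤ, ∑ s ∈ Finset.range (m + 1), ((k + 1).choose (2 * s + 1) : ℤ) * z s = 2 ^ k * w := by
  induction hz using AddSubgroup.closure_induction with
  | mem x hx =>
    obtain ⟨r, rfl⟩ := hx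
    refine ⟨((k - r).choose r : ℕ), ?_⟩
    have h := four_pow_mul_sum_choose_odd k r m hm
    rw [Finset.mul_sum] at h
    have h' := congrArg (Nat.cast : ℕ → ℤ) h
    push_cast at h'
    rw [← h']
    exact Finset.sum_congr rfl fun s _ => by rw [newton]; ring
  | zero => exact ⟨0, by simp⟩
  | add x y _ _ hx hy =>
    obtain ⟨a, ha⟩ := hx
    obtain ⟨b, hb⟩ := hy
    exact ⟨a + b, by simp only [Pi.add_apply, mul_add, Finset.sum_add_distrib, ha, hb]⟩
  | neg x _ hx =>
    obtain ⟨a, ha⟩ := hx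
    exact ⟨-a, by simp only [Pi.neg_apply, mul_neg, Finset.sum_neg_distrib, ha]⟩

theorem sum_choose_odd_mul_newton {k m : ℕ} (hm : k < m) (r : ℕ) :
    ∑ s ∈ Finset.range (m + 1), ((k + 1).choose (2 * s + 1) : ℤ) * newton r s =
      2 ^ k * ((k - r).choose r : ℕ) := by
  have h := congrArg (Nat.cast : ℕ → ℤ) (four_pow_mul_sum_choose_odd k r m hm)
  rw [Finset.mul_sum] at h
  push_cast at h
  rw [← h]
  exact Finset.sum_congr rfl fun s _ => by rw [newton]; ring

theorem exists_sum_choose_odd_mul_pow {c h k : ℕ} (hc : Odd c) (hk : k + 1 ≤ 2 ^ (h + 1)) :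
    ∃ w : ℤ, ∑ s ∈ Finset.range (k + 1 + 1),
        ((k + 1).choose (2 * s + 1) : ℤ) * (1 + 2 * s : ℤ) ^ (c * 2 ^ h) =
      2 ^ k * (1 + ((∑ j ∈ Finset.Ico 1 h,
        (k - (2 ^ h - 2 ^ j)).choose (2 ^ h - 2 ^ j) : ℕ) : ℤ) + 2 * w) := by
  obtain ⟨z, hz, e⟩ := exists_one_add_two_mul_pow_of_odd h hc
  obtain ⟨w, hw⟩ := exists_sum_choose_odd_mul (Nat.lt_succ_self k) hz
  refine ⟨w, ?_⟩
  have h1 := sum_choose_odd_mul_newton (Nat.lt_succ_self k) 0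
  have hA : ∑ s ∈ Finset.range (k + 1 + 1), ((k + 1).choose (2 * s + 1) : ℤ) * oddPart h s =
      2 ^ k * ((∑ j ∈ Finset.Ico 1 h,
        (k - (2 ^ h - 2 ^ j)).choose (2 ^ h - 2 ^ j) : ℕ) : ℤ) := by
    simp only [oddPart, Finset.sum_apply, Finset.mul_sum, Nat.cast_sum]
    rw [Finset.sum_comm]
    exact Finset.sum_congr rfl fun j _ => sum_choose_odd_mul_newton (Nat.lt_succ_self k) _
  have hterm : ∀ s ∈ Finset.range (k + 1 + 1),
      ((k + 1).choose (2 * s + 1) : ℤ) * (1 + 2 * s : ℤ) ^ (c * 2 ^ h) =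
      ((k + 1).choose (2 * s + 1) : ℤ) * newton 0 s +
      ((k + 1).choose (2 * s + 1) : ℤ) * oddPart h s +
      2 * (((k + 1).choose (2 * s + 1) : ℤ) * z s) := by
    intro s _
    -- The expansion is only valid for `s < 2 ^ h`; otherwise `2 * s + 1` exceeds `k + 1`.
    rcases Nat.lt_or_ge s (2 ^ h) with hs | hs
    · rw [e s hs, newton_zero, Pi.one_apply]; ring
    · rw [Nat.choose_eq_zero_of_lt (by rw [pow_succ] at hk; omega)]; simp
  rw [Finset.sum_congr rfl hterm, Finset.sum_add_distrib, Finset.sum_add_distrib, h1, hA,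
    ← Finset.mul_sum, hw]
  simp only [Nat.sub_zero, Nat.choose_zero_right, Nat.cast_one]
  ring

/-- The even bases contribute a multiple of `2 ^ n`, hence of `2 ^ (k + 1)`,
so the parity of the cofactor of `2 ^ k` is decided by the odd bases. -/
theorem exists_factorial_mul_stirlingSecond_eq {c h k : ℕ} (hc3 : 3 ≤ c) (hc : Odd c)
    (hk : k + 1 ≤ 2 ^ (h + 1)) :
    ∃ u : ℤ, (((k + 1).factorial * (c * 2 ^ h).stirlingSecond (k + 1) : ℕ) : ℤ) = 2 ^ k * u ∧
      (Odd u ↔ ¬(2 ≤ 2 ^ (h + 1) - (k + 1) ∧ 2 ^ (h + 1) - (k + 1) < 2 ^ h)) := by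
  obtain ⟨w, hw⟩ := exists_sum_choose_odd_mul_pow (h := h) hc hk
  have hn : k + 1 ≤ c * 2 ^ h := by
    rw [pow_succ] at hk
    nlinarith [Nat.mul_le_mul_right (2 ^ h) hc3]
  obtain ⟨v, hv⟩ : (2 : ℤ) ^ (k + 1) ∣ ∑ s ∈ Finset.range (k + 1 + 1),
      ((k + 1).choose (2 * s) : ℤ) * (2 * s : ℤ) ^ (c * 2 ^ h) :=
    Finset.dvd_sum fun s _ => Dvd.dvd.mul_left
      ((pow_dvd_pow 2 hn).trans (by rw [mul_pow]; exact dvd_mul_right _ _)) _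
  have hpar := sum_choose_two_pow_sub_cast hk
  set B := ∑ j ∈ Finset.Ico 1 h, (k - (2 ^ h - 2 ^ j)).choose (2 ^ h - 2 ^ j) with hB
  refine ⟨(-1) ^ (k + 1) * (2 * v - (1 + B + 2 * w)), ?_, ?_⟩
  · rw [factorial_mul_stirlingSecond, hw, hv]
    ring
  · have h1 : Odd ((-1 : ℤ) ^ (k + 1) * (2 * v - (1 + B + 2 * w))) ↔ Even B := by
      rw [Int.odd_mul, and_iff_right (Odd.pow (by decide)), ← Int.even_coe_nat]
      simp only [Int.odd_iff, Int.even_iff]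
      omega
    rw [h1, ← ZMod.natCast_eq_zero_iff_even, hpar]
    split_ifs with h2
    · simp [h2]
    · simp [h2]

theorem stirlingSecond_pos : ∀ {n k : ℕ}, k + 1 ≤ n → 0 < n.stirlingSecond (k + 1)
  | n + 1, 0, _ => by rw [Nat.stirlingSecond_one_right]; exact one_pos
  | n + 1, k + 1, h => by
    rw [Nat.stirlingSecond_succ_succ]
    exact Nat.add_pos_right _ (stirlingSecond_pos (by omega))

/-- Legendre's formula turns the factor `2 ^ (k - 1)` of `k! S(n,k)` into the bound
`sigma k - 1`, which is attained exactly if the cofactor is odd. -/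
theorem sigma_sub_one_le_nuS_and_eq_iff {c h k : ℕ} (hc3 : 3 ≤ c) (hc : Odd c) (hk : 1 ≤ k)
    (hk2 : k ≤ 2 ^ (h + 1)) :
    (sigma k : ℤ) - 1 ≤ nuS (c * 2 ^ h) k ∧
      (nuS (c * 2 ^ h) k = (sigma k : ℤ) - 1 ↔ k ≤ 2 ^ h ∨ 2 ^ (h + 1) ≤ k + 1) := by
  obtain ⟨k, rfl⟩ := Nat.exists_eq_add_of_le' hk
  have := Fact.mk Nat.prime_two
  obtain ⟨u, hu, hodd⟩ := exists_factorial_mul_stirlingSecond_eq hc3 hc hk2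
  have hn : k + 1 ≤ c * 2 ^ h := by
    rw [pow_succ] at hk2
    nlinarith [Nat.mul_le_mul_right (2 ^ h) hc3]
  have hS := stirlingSecond_pos hn
  have hf := Nat.factorial_pos (k + 1)
  have hu0 : u ≠ 0 := by
    rintro rfl
    rw [mul_zero, Nat.cast_eq_zero] at hu
    exact (Nat.mul_pos hf hS).ne' hu
  have hval := congrArg (padicValInt 2) hu
  rw [padicValInt.of_nat, padicValNat.mul hf.ne' hS.ne', padicValInt.mul (by positivity) hu0,
    show (2 : ℤ) ^ k = ((2 ^ k : ℕ) : ℤ) by push_cast; rfl, padicValInt.of_nat,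
    padicValNat.prime_pow] at hval
  have hleg := sub_one_mul_padicValNat_factorial (p := 2) (k + 1)
  have hdig := Nat.digit_sum_le 2 (k + 1)
  change _ = k + 1 - sigma (k + 1) at hleg
  change sigma (k + 1) ≤ k + 1 at hdig
  have hv : padicValInt 2 u = 0 ↔ Odd u := by
    rw [← Int.not_even_iff_odd, even_iff_two_dvd]
    have := padicValInt_dvd_iff (p := 2) 1 u
    rw [pow_one] at this
    norm_num at this
    rw [this]
    omega
  have hN : 2 ^ (h + 1) = 2 * 2 ^ h := by ring
  rw [nuS]
  refine ⟨by omega, ?_⟩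
  have hcond : (k + 1 ≤ 2 ^ h ∨ 2 ^ (h + 1) ≤ k + 1 + 1) ↔ padicValInt 2 u = 0 := by
    rw [hv, hodd]; omega
  rw [hcond]
  omega

theorem isAMZC_of_nuS_eq {c h k : ℕ} (hc3 : 3 ≤ c) (hc : Odd c) (hk : 1 ≤ k)
    (hk2 : k ≤ 2 ^ (h + 1)) (hnu : nuS (c * 2 ^ h) k = (sigma k : ℤ) - 1) :
    IsAMZC (c * 2 ^ h) k := by
  refine ⟨hnu.trans (amzEstimate_eq hc3 hc hk hk2).symm, fun hM => ?_⟩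
  rw [IsMZC, mzEstimate, hnu, sigma_mul_two_pow] at hM
  have := two_le_sigma hc3 hc
  omega

theorem sigma_two_pow_add {h a : ℕ} (ha : a < 2 ^ h) : sigma (2 ^ h + a) = sigma a + 1 := by
  have := sigma_mul_two_pow_add 1 h a ha
  rw [one_mul] at this
  rw [this, add_comm, show sigma 1 = 1 from sigma_two_pow 0]
end StirlingTwo

theorem theorem3p4 (c h n : ℕ) (hc : 3 ≤ c) (hodd : Odd c) (hn : n = c * 2 ^ h) :
    (∀ k : ℕ, 1 ≤ k → k ≤ 2 ^ h →
      StirlingTwo.IsAMZC n k ∧ StirlingTwo.nuS n k = (StirlingTwo.sigma k : ℤ) - 1) ∧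
    (∀ k a : ℕ, k = 2 ^ h + a → 0 < a → a < 2 ^ h →
      StirlingTwo.amzEstimate n k = (StirlingTwo.sigma a : ℤ) ∧
      (StirlingTwo.sigma a : ℤ) = (StirlingTwo.sigma k : ℤ) - 1 ∧
      StirlingTwo.nuS n k ≥ (StirlingTwo.sigma a : ℤ)) ∧
    (∀ k a : ℕ, k = 2 ^ h + a → 0 < a → a + 1 < 2 ^ h →
      ¬ StirlingTwo.AMZSharp n k ∧ ¬ StirlingTwo.IsAMZC n k ∧
      StirlingTwo.nuS n k ≥ (StirlingTwo.sigma a : ℤ) + 1 ∧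
      (StirlingTwo.sigma a : ℤ) + 1 = (StirlingTwo.sigma k : ℤ)) ∧
    (∀ k a : ℕ, k = 2 ^ h + a → a + 1 = 2 ^ h →
      k = 2 ^ (h + 1) - 1 ∧ StirlingTwo.IsAMZC n k ∧
      StirlingTwo.nuS n k = (StirlingTwo.sigma a : ℤ) ∧ (StirlingTwo.sigma a : ℤ) = (h : ℤ)) ∧
    (StirlingTwo.IsAMZC n (2 ^ (h + 1)) ∧
      StirlingTwo.SAMZSharp n (2 ^ (h + 1)) ∧
      (StirlingTwo.IsSAMZC n (2 ^ (h + 1)) ↔ 3 ≤ StirlingTwo.sigma c) ∧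
      StirlingTwo.nuS n (2 ^ (h + 1)) = 0 ∧
      Odd (Nat.stirlingSecond n (2 ^ (h + 1)))) := by
  open StirlingTwo in
  subst hn
  have hN : 0 < 2 ^ h := by positivity
  have hN1 : 2 ^ (h + 1) = 2 * 2 ^ h := by ring
  refine ⟨fun k hk1 hk2 => ?_, fun k a hk ha ha2 => ?_, fun k a hk ha ha2 => ?_,
    fun k a hk ha => ?_, ?_⟩
  · have hnu := (sigma_sub_one_le_nuS_and_eq_iff hc hodd hk1 (by omega)).2.2 (Or.inl hk2)
    exact ⟨isAMZC_of_nuS_eq hc hodd hk1 (by omega) hnu, hnu⟩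
  · have hs := hk ▸ sigma_two_pow_add ha2
    have h1 := amzEstimate_eq hc hodd (k := k) (h := h) (by omega) (by omega)
    have h2 := (sigma_sub_one_le_nuS_and_eq_iff hc hodd (k := k) (h := h)
      (by omega) (by omega)).1
    refine ⟨?_, ?_, ?_⟩ <;> omega
  · have hs := hk ▸ sigma_two_pow_add (show a < 2 ^ h by omega)
    have h1 := amzEstimate_eq hc hodd (k := k) (h := h) (by omega) (by omega)
    obtain ⟨h2, h3⟩ := sigma_sub_one_le_nuS_and_eq_iff hc hodd (k := k) (h := h)
      (by omega) (by omega)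
    have h4 : nuS (c * 2 ^ h) k ≠ (sigma k : ℤ) - 1 := fun e => by
      have := h3.1 e
      omega
    have h5 : ¬ AMZSharp (c * 2 ^ h) k := fun e => h4 (Eq.trans e h1)
    exact ⟨h5, fun e => h5 e.1, by omega, by omega⟩
  · have hs := hk ▸ sigma_two_pow_add (show a < 2 ^ h by omega)
    have hnu := (sigma_sub_one_le_nuS_and_eq_iff hc hodd (k := k) (h := h)
      (by omega) (by omega)).2.2
      (Or.inr (by omega))
    have ha' : sigma a = h := by
      rw [show a = 2 ^ h - 1 by omega, sigma_two_pow_sub_one]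
    exact ⟨by omega, isAMZC_of_nuS_eq hc hodd (by omega) (by omega) hnu, by omega, by omega⟩
  · have hnu := (sigma_sub_one_le_nuS_and_eq_iff hc hodd (k := 2 ^ (h + 1)) (h := h)
      (by omega) le_rfl).2.2
      (Or.inr (by omega))
    have h0 : nuS (c * 2 ^ h) (2 ^ (h + 1)) = 0 := by
      rw [hnu, sigma_two_pow]; norm_num
    have hsharp : SAMZSharp (c * 2 ^ h) (2 ^ (h + 1)) :=
      h0.trans (samzEstimate_two_pow hc hodd).symm
    refine ⟨isAMZC_of_nuS_eq hc hodd (by omega) le_rfl hnu, hsharp, ?_, h0, ?_⟩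
    · have h2 := two_le_sigma hc hodd
      rw [IsSAMZC, and_iff_right hsharp, IsSMZC, h0, smzEstimate_two_pow hc hodd]
      omega
    · have hle : 2 ^ (h + 1) - 1 + 1 ≤ c * 2 ^ h := by
        have := Nat.mul_le_mul_right (2 ^ h) hc
        omega
      have hpos := stirlingSecond_pos hle
      rw [show 2 ^ (h + 1) - 1 + 1 = 2 ^ (h + 1) by omega] at hpos
      rw [nuS, Nat.cast_eq_zero, padicValNat.eq_zero_iff] at h0
      rw [← Nat.not_even_iff_odd, even_iff_two_dvd]
      rcases h0 with h | h | h
      · omega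
      · omega
      · exact h
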